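/- For an open subset $\Omega$ of some $\mathbb C^m$, a continuous function $u:\Omega\to\mathbb R$ is plurisubharmonic if $u(z)\le\frac1{2\pi}\int_0^{2\pi}u(z+e^{i\theta}w)\,d\theta$ for all $z,w\in\mathbb C^m$ such that $z+\tau w\in\Omega$ whenever $\tau\in\mathbb C$, $|\tau|\le1$. The open set $\Omega$ (connected or not) is called pseudoconvex if there is a continuous plurisubharmonic function $u:\Omega\to\mathbb R$ such that $\{z\in\Omega:u(z)<c\}$ is relatively compact in $\Omega$ for every $c\in\mathbb R$. Let $n\ge0$ and let $D\subsetneq\mathbb C^n$ be a proper open subset. For $z\in D$ let $$I_{D,z}=\{X\in\mathbb C^n: z+\lambda X\in D\text{ for all }\lambda\in\mathbb C\text{ with }|\lambda|\le1\},\qquad B_{D,z}=z+I_{D,z},$$ so that $B_{D,z}$ is the largest balanced domain centred at $z$ and contained in $D$, and let $$H_D=\{(z,w)\in D\times\mathbb C^n: w\in I_{D,z}\}\subset\mathbb C^{2n}.$$ Theorem. The following properties are equivalent: 1. $D$ is pseudoconvex; 2. $H_D$ is pseudoconvex; 3. $B_{D,z}$ is pseudoconvex for every $z\in D$. -/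

import Mathlib

/-- `u` is a continuous (real-valued) plurisubharmonic function on the set `D` of a complex normed
space: it is continuous on `D` and has the sub-mean value property on every closed disc
`{z + τ w : |τ| ≤ 1}` of a complex line that is contained in `D`.  (As `u` is continuous on the
compact boundary circle, the average is that of an integrable function.) -/
structure IsContinuousPlurisubharmonicOn {E : Type*} [NormedAddCommGroup E] [NormedSpace ℂ E]
    (u : E → ℝ) (D : Set E) : Prop where
  continuousOn : ContinuousOn u D
  le_circleAverage : ∀ z w : E, (∀ τ : ℂ, ‖τ‖ ≤ 1 → z + τ • w ∈ D) →
    u z ≤ Real.circleAverage (fun τ : ℂ => u (z + τ • w)) 0 1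

/-- A set `D` of a finite-dimensional complex vector space is pseudoconvex if it is open and there
is a continuous plurisubharmonic function `u` on `D` such that `{z ∈ D : u z < c}` is relatively
compact in `D` for every real `c`.  (Connectedness is not required.) -/
def IsPseudoconvex {E : Type*} [NormedAddCommGroup E] [NormedSpace ℂ E] [FiniteDimensional ℂ E]
    (D : Set E) : Prop :=
  IsOpen D ∧ ∃ u : E → ℝ, IsContinuousPlurisubharmonicOn u D ∧
    ∀ c : ℝ, IsCompact (closure {z ∈ D | u z < c}) ∧ closure {z ∈ D | u z < c} ⊆ D

/-- The balanced indicatrix `I_{D,z}` of `D` at `z`. -/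
def balancedIndicatrix {E : Type*} [NormedAddCommGroup E] [NormedSpace ℂ E]
    (D : Set E) (z : E) : Set E :=
  {X : E | ∀ l : ℂ, ‖l‖ ≤ 1 → z + l • X ∈ D}

/-- `B_{D,z} = z + I_{D,z}`, the largest balanced domain centred at `z` and contained in `D`
(for open `D` and `z ∈ D`). -/
def largestBalanced {E : Type*} [NormedAddCommGroup E] [NormedSpace ℂ E]
    (D : Set E) (z : E) : Set E :=
  (fun X : E => z + X) '' balancedIndicatrix D z

/-- The Hartogs-like domain `H_D = {(z, w) : z ∈ D, w ∈ I_{D,z}}`. -/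
def hartogsLike {E : Type*} [NormedAddCommGroup E] [NormedSpace ℂ E] (D : Set E) : Set (E × E) :=
  {p : E × E | p.1 ∈ D ∧ p.2 ∈ balancedIndicatrix D p.1}

open Metric Filter Topology Polynomial

/-! The substantial implication is 3 ⇒ 1, proved by showing that `1 / infDist z Dᶜ` is
plurisubharmonic. If it is not, then on some complex line it is touched from above at a point `z` by
a strictly superharmonic quadratic (`le_circleAverage_of_not_touched`). Let `X` point from `z` to a
nearest boundary point. Inverting the inequality puts into `D` all points `z + σ w + ζ X` with `‖ζ‖
< ‖g σ‖ (1 + ε ‖σ‖²)`, where `g` is a quadratic polynomial and `g 0 = 1`.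

Move the centre to `z' = z + (1 - s) X`. Quadratic discs shrunk by `ρ < 1` lie in the largest
balanced domain at `z'` (`exists_norm_lt_norm_quadratic`). Their boundaries stay in a compact part
of it as `ρ → 1`, while their centres tend to `z + X ∉ D`. The maximum principle on these discs
forbids this if the balanced domain is pseudoconvex.

For 1 ⇒ 2 take the supremum of `u` over the disc `{z + l w : ‖l‖ ≤ 1}`; for 2 ⇒ 3 slice `H_D`. -/

/-! ### Testing the sub-mean value property with quadratic polynomials. -/

theorem circleAverage_re_eval (p : ℂ[X]) :
    Real.circleAverage (fun τ => (p.eval τ).re) 0 1 = (p.eval 0).re := by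
  have h1 : Real.circleAverage (fun τ => p.eval τ) 0 1 = p.eval 0 :=
    DiffContOnCl.circleAverage (Differentiable.diffContOnCl p.differentiable)
  have h2 := Complex.reCLM.circleAverage_comp_comm (f := fun τ => p.eval τ) (c := 0) (R := 1)
    (ContinuousOn.circleIntegrable (by norm_num) p.continuous.continuousOn)
  rw [h1] at h2
  exact h2

theorem norm_add_sq_complex (a b : ℂ) :
    ‖a + b‖ ^ 2 = ‖a‖ ^ 2 + ‖b‖ ^ 2 + 2 * ((starRingEnd ℂ) a * b).re := by
  simp only [Complex.sq_norm, Complex.normSq_apply, Complex.add_re, Complex.add_im, Complex.mul_re,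
    Complex.conj_re, Complex.conj_im]
  ring

theorem exists_polynomial_of_mem_span_fourier {f : C(UnitAddCircle, ℂ)}
    (hf : f ∈ Submodule.span ℂ (Set.range (@fourier 1))) :
    ∃ p q : ℂ[X], ∀ x, f x = p.eval (AddCircle.toCircle x : ℂ) +
      (starRingEnd ℂ) (q.eval (AddCircle.toCircle x : ℂ)) := by
  induction hf using Submodule.span_induction with
  | mem f hf =>
    obtain ⟨n, rfl⟩ := hf
    obtain ⟨k, rfl | rfl⟩ := n.eq_nat_or_neg
    · exact ⟨X ^ k, 0, fun x => by simp [AddCircle.toCircle_nsmul]⟩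
    · exact ⟨0, X ^ k, fun x => by rw [fourier_neg]; simp [AddCircle.toCircle_nsmul]⟩
  | zero => exact ⟨0, 0, by simp⟩
  | add f g _ _ hf hg =>
    obtain ⟨p, q, h⟩ := hf
    obtain ⟨p', q', h'⟩ := hg
    exact ⟨p + p', q + q', fun x => by simp [h, h']; ring⟩
  | smul c f _ hf =>
    obtain ⟨p, q, h⟩ := hf
    exact ⟨C c * p, C ((starRingEnd ℂ) c) * q, fun x => by simp [h]; ring⟩

/-- Continuous functions on the unit circle are approximated from above by real parts of
polynomials. -/
theorem exists_polynomial_re_approx {U : ℂ → ℝ} (hU : ContinuousOn U (sphere 0 1)) {ε : ℝ}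
    (hε : 0 < ε) :
    ∃ f : ℂ[X], ∀ τ ∈ sphere (0 : ℂ) 1, U τ < (f.eval τ).re ∧ (f.eval τ).re < U τ + ε := by
  let g : C(UnitAddCircle, ℂ) :=
    ⟨fun x => (U (AddCircle.toCircle x : ℂ) : ℂ), Complex.continuous_ofReal.comp
      (hU.comp_continuous (continuous_induced_dom.comp AddCircle.continuous_toCircle)
        (fun x => by rw [mem_sphere_zero_iff_norm]; exact Circle.norm_coe _))⟩
  have hg : g ∈ (Submodule.span ℂ (Set.range (@fourier 1))).topologicalClosure := by
    rw [span_fourier_closure_eq_top]; trivial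
  obtain ⟨h, hh, hgh⟩ := Metric.mem_closure_iff.1 hg (ε / 2) (by positivity)
  obtain ⟨p, q, hpq⟩ := exists_polynomial_of_mem_span_fourier hh
  -- `q` and its conjugate have the same real part; the shift by `ε / 2` makes the error one-sided.
  refine ⟨p + q + C ((ε / 2 : ℝ) : ℂ), fun τ hτ => ?_⟩
  obtain ⟨x, hx⟩ := (AddCircle.homeomorphCircle (one_ne_zero : (1 : ℝ) ≠ 0)).surjective
    ⟨τ, by simpa [Submonoid.unitSphere] using hτ⟩
  have hx' : (AddCircle.toCircle x : ℂ) = τ := by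
    rw [AddCircle.homeomorphCircle_apply] at hx
    rw [hx]
  have h1 : dist (g x) (h x) < ε / 2 := (ContinuousMap.dist_apply_le_dist x).trans_lt hgh
  have h2 : |(g x - h x).re| < ε / 2 := (Complex.abs_re_le_norm _).trans_lt (by rwa [← dist_eq_norm])
  have h3 : g x = (U τ : ℂ) := by simp [g, hx']
  rw [h3, hpq x, hx'] at h2
  simp only [Complex.sub_re, Complex.add_re, Complex.conj_re, Complex.ofReal_re, abs_lt] at h2
  simp only [eval_add, eval_C, Complex.add_re, Complex.ofReal_re]
  constructor <;> linarith

/-- A continuous function on the closed unit disc which is nowhere touched from above by a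
strictly superharmonic quadratic polynomial has the sub-mean value property at the centre. -/
theorem le_circleAverage_of_not_touched {U : ℂ → ℝ} (hU : ContinuousOn U (closedBall 0 1))
    (h : ∀ τ₀ ∈ ball (0 : ℂ) 1, ∀ b c : ℂ, ∀ ε > 0, ∀ r > 0,
      ∃ σ : ℂ, ‖σ‖ ≤ r ∧ U τ₀ + (b * σ + c * σ ^ 2).re - ε * ‖σ‖ ^ 2 < U (τ₀ + σ)) :
    U 0 ≤ Real.circleAverage U 0 1 := by
  by_contra! hlt
  have hUs : ContinuousOn U (sphere 0 1) := hU.mono sphere_subset_closedBall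
  obtain ⟨f, hf⟩ := exists_polynomial_re_approx hUs (ε := U 0 - Real.circleAverage U 0 1)
    (by linarith)
  have hf0 : (f.eval 0).re < U 0 := by
    have hfI : CircleIntegrable (fun τ => (f.eval τ).re) 0 1 :=
      ContinuousOn.circleIntegrable (by norm_num)
        (Complex.continuous_re.comp f.continuous).continuousOn
    have hUI : CircleIntegrable U 0 1 := ContinuousOn.circleIntegrable (by norm_num) hUs
    obtain ⟨e, he, he'⟩ : ∃ e, (∀ τ ∈ sphere (0 : ℂ) 1, (f.eval τ).re ≤ U τ + e) ∧
        e < U 0 - Real.circleAverage U 0 1 := by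
      obtain ⟨t, ht, hmax⟩ := (isCompact_sphere (0 : ℂ) 1).exists_isMaxOn
        (NormedSpace.sphere_nonempty.2 zero_le_one)
        (f := fun τ => (f.eval τ).re - U τ)
        ((Complex.continuous_re.comp f.continuous).continuousOn.sub hUs)
      refine ⟨(f.eval t).re - U t, fun τ hτ => ?_, by linarith [(hf t ht).2]⟩
      have : (f.eval τ).re - U τ ≤ (f.eval t).re - U t := hmax hτ
      linarith
    have hmono := Real.circleAverage_mono hfI
      (f₂ := fun τ => U τ + e) (hUI.add (circleIntegrable_const e 0 1))
      (fun τ hτ => he τ (by simpa using hτ))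
    rw [circleAverage_re_eval, Real.circleAverage_fun_add hUI (circleIntegrable_const e 0 1),
      Real.circleAverage_const] at hmono
    linarith
  set ε : ℝ := (U 0 - (f.eval 0).re) / 2 with hεdef
  have hε : 0 < ε := by rw [hεdef]; linarith
  -- This function is below `ε` on the circle and equals `2ε` at the centre, so its maximum is
  -- interior.
  obtain ⟨τ₀, hτ₀, hmax⟩ := (isCompact_closedBall (0 : ℂ) 1).exists_isMaxOn
    (nonempty_closedBall.2 zero_le_one)
    (f := fun τ => U τ - (f.eval τ).re + ε * ‖τ‖ ^ 2)
    ((hU.sub (Complex.continuous_re.comp f.continuous).continuousOn).add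
      (by fun_prop))
  have hmax' : ∀ τ : ℂ, ‖τ‖ ≤ 1 → U τ - (f.eval τ).re + ε * ‖τ‖ ^ 2 ≤
      U τ₀ - (f.eval τ₀).re + ε * ‖τ₀‖ ^ 2 := fun τ hτ => hmax (by simpa using hτ)
  have hlt1 : ‖τ₀‖ < 1 := by
    have hle : ‖τ₀‖ ≤ 1 := by simpa using hτ₀
    refine lt_of_le_of_ne hle fun heq => ?_
    have h0 := hmax' 0 (by simp)
    have h1 := (hf τ₀ (by simpa using heq)).1
    rw [heq] at h0
    simp only [norm_zero] at h0
    linarith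
  obtain ⟨a, b, H, hH⟩ : ∃ (a b : ℂ) (H : ℂ[X]), ∀ σ, f.eval (τ₀ + σ) =
      f.eval τ₀ + a * σ + b * σ ^ 2 + σ ^ 3 * H.eval σ := by
    set q := f.comp (X + C τ₀) with hq
    refine ⟨q.divX.coeff 0, q.divX.divX.coeff 0, q.divX.divX.divX, fun σ => ?_⟩
    have e1 := congrArg (eval σ) q.divX_mul_X_add
    have e2 := congrArg (eval σ) q.divX.divX_mul_X_add
    have e3 := congrArg (eval σ) q.divX.divX.divX_mul_X_add
    simp only [eval_add, eval_mul, eval_X, eval_C] at e1 e2 e3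
    have e0 : q.coeff 0 = f.eval τ₀ := by rw [coeff_zero_eq_eval_zero, hq]; simp
    have e4 : q.eval σ = f.eval (τ₀ + σ) := by rw [hq]; simp [add_comm]
    rw [← e4, ← e1, ← e2, ← e3, e0]
    ring
  have hev : ∀ᶠ σ : ℂ in 𝓝 0, ‖σ * H.eval σ‖ < ε / 2 := by
    have hc : Continuous fun σ : ℂ => ‖σ * H.eval σ‖ := (continuous_id.mul H.continuous).norm
    exact (hc.tendsto 0).eventually_lt_const (by simpa using hε)
  obtain ⟨r, hr, hball⟩ := Metric.eventually_nhds_iff.1 hev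
  -- The linear coefficient absorbs the cross term of `‖τ₀ + σ‖²`; half of `ε` is spent on the cubic
  -- remainder.
  obtain ⟨σ, hσ, hlt2⟩ := h τ₀ (by simpa using hlt1) (a - 2 * ε * (starRingEnd ℂ) τ₀) b (ε / 2)
    (by positivity) (min (r / 2) (1 - ‖τ₀‖)) (lt_min (by positivity) (by linarith))
  have hσ1 : ‖σ * H.eval σ‖ < ε / 2 := hball (by
    rw [dist_zero_right]; exact (hσ.trans (min_le_left _ _)).trans_lt (by linarith))
  have hσ2 := hmax' (τ₀ + σ) ((norm_add_le _ _).trans (by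
    linarith [hσ.trans (min_le_right _ _)]))
  have h3 : (σ ^ 3 * H.eval σ).re ≤ ε / 2 * ‖σ‖ ^ 2 := by
    refine (Complex.re_le_norm _).trans ?_
    have : σ ^ 3 * H.eval σ = σ ^ 2 * (σ * H.eval σ) := by ring
    rw [this, norm_mul, norm_pow, mul_comm]
    gcongr
  rw [hH, norm_add_sq_complex] at hσ2
  have h4 : ((a - 2 * ε * (starRingEnd ℂ) τ₀) * σ + b * σ ^ 2).re =
      (a * σ).re + (b * σ ^ 2).re - 2 * ε * ((starRingEnd ℂ) τ₀ * σ).re := by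
    rw [sub_mul, Complex.add_re, Complex.sub_re, mul_assoc,
      show (2 * (ε : ℂ)) = ((2 * ε : ℝ) : ℂ) by push_cast; rfl, Complex.re_ofReal_mul]
    ring
  rw [h4] at hlt2
  simp only [Complex.add_re] at hσ2
  linarith

/-! ### Elementary estimates for quadratic polynomials. -/

/-- The disc `λ ↦ 1 - s + λ (s + α x + β x²)` stays below `g (λ x) = 1 + α λ x + β (λ x)²`, up to
an arbitrarily small quadratic correction. -/
theorem exists_norm_lt_norm_quadratic (α β : ℂ) {ε : ℝ} (hε : 0 < ε) :
    ∃ s : ℝ, 0 < s ∧ s < 1 ∧ ∃ r > 0, ∀ x l : ℂ, ‖x‖ ≤ r → ‖l‖ ≤ 1 → (x ≠ 0 ∨ l ≠ 1) →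
      ‖1 - s + l * (s + α * x + β * x ^ 2)‖ <
        ‖1 + α * (l * x) + β * (l * x) ^ 2‖ * (1 + ε * ‖l * x‖ ^ 2) := by
  set K : ℝ := 2 * (2 * ‖β‖ + ‖α‖) + 1 with hK
  have hα := norm_nonneg α
  have hβ := norm_nonneg β
  have hK1 : 1 ≤ K := by linarith
  set s : ℝ := min (1 / 2) (ε / (8 * K ^ 2)) with hs
  have hs0 : 0 < s := lt_min (by norm_num) (by positivity)
  have hs2 : s ≤ 1 / 2 := min_le_left _ _
  have hsK : 8 * s * K ^ 2 ≤ ε := by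
    have : s ≤ ε / (8 * K ^ 2) := min_le_right _ _
    rw [le_div_iff₀ (by positivity)] at this
    linarith
  refine ⟨s, hs0, by linarith, min s (1 / (16 * K)), lt_min hs0 (by positivity), ?_⟩
  intro x l hx hl hne
  have hxs : ‖x‖ ≤ s := hx.trans (min_le_left _ _)
  have hxK : K * ‖x‖ ≤ 1 / 16 := by
    have : ‖x‖ ≤ 1 / (16 * K) := hx.trans (min_le_right _ _)
    rw [le_div_iff₀ (by positivity)] at this
    linarith
  have hx0 := norm_nonneg x
  have hl0 := norm_nonneg l
  set g : ℂ := 1 + α * (l * x) + β * (l * x) ^ 2 with hg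
  -- Both corrections to `g` carry the factor `1 - l`, and `e = O(s ‖x‖)` because `‖x‖ ≤ s`.
  set e : ℂ := -(β * l * x ^ 2) - s * (α * (l * x) + β * (l * x) ^ 2) with he
  have hN : 1 - s + l * (s + α * x + β * x ^ 2) = g * (1 - (1 - l) * s) - (1 - l) * e := by
    rw [hg, he]; ring
  have hlx : ‖l‖ * ‖x‖ ≤ ‖x‖ := mul_le_of_le_one_left hx0 hl
  have hlxsq : (‖l‖ * ‖x‖) ^ 2 ≤ s * ‖x‖ := by
    have : (‖l‖ * ‖x‖) ^ 2 ≤ ‖x‖ ^ 2 := by gcongr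
    nlinarith
  have hq : ‖α * (l * x) + β * (l * x) ^ 2‖ ≤ (‖α‖ + ‖β‖) * ‖x‖ := by
    refine (norm_add_le _ _).trans ?_
    rw [norm_mul, norm_mul, norm_mul, norm_pow, norm_mul]
    have h1 : ‖α‖ * (‖l‖ * ‖x‖) ≤ ‖α‖ * ‖x‖ := by gcongr
    have h2 : ‖β‖ * (‖l‖ * ‖x‖) ^ 2 ≤ ‖β‖ * ‖x‖ := by
      gcongr; nlinarith
    linarith
  have hg2 : 1 / 2 ≤ ‖g‖ := by
    have h1 : ‖(1 : ℂ)‖ ≤ ‖g‖ + ‖α * (l * x) + β * (l * x) ^ 2‖ := by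
      have : (1 : ℂ) = g - (α * (l * x) + β * (l * x) ^ 2) := by rw [hg]; ring
      calc ‖(1 : ℂ)‖ = ‖g - (α * (l * x) + β * (l * x) ^ 2)‖ := by rw [← this]
        _ ≤ _ := norm_sub_le _ _
    rw [norm_one] at h1
    nlinarith
  have he1 : ‖e‖ ≤ ‖g‖ * (s * (K * ‖x‖)) := by
    have h1 : ‖e‖ ≤ s * ((2 * ‖β‖ + ‖α‖) * ‖x‖) := by
      refine (norm_sub_le _ _).trans ?_
      rw [norm_neg, norm_mul, norm_mul, norm_pow, norm_mul (s : ℂ), Complex.norm_real,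
        Real.norm_of_nonneg hs0.le]
      have h2 : ‖β‖ * ‖l‖ * ‖x‖ ^ 2 ≤ ‖β‖ * 1 * (s * ‖x‖) := by
        gcongr; nlinarith
      have h3 := mul_le_mul_of_nonneg_left hq hs0.le
      linarith
    have h2 : s * ((2 * ‖β‖ + ‖α‖) * ‖x‖) ≤ 1 / 2 * (s * (K * ‖x‖)) := by
      have : (2 * ‖β‖ + ‖α‖) ≤ 1 / 2 * K := by linarith
      calc s * ((2 * ‖β‖ + ‖α‖) * ‖x‖) ≤ s * ((1 / 2 * K) * ‖x‖) := by gcongr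
        _ = _ := by ring
    refine h1.trans (h2.trans ?_)
    gcongr
  set m : ℝ := ‖1 - l‖ with hm
  have hm0 : 0 ≤ m := norm_nonneg _
  have hm2 : m ≤ 2 := (norm_sub_le _ _).trans (by rw [norm_one]; linarith)
  have hA : ‖1 - (1 - l) * s‖ ≤ 1 - s * m ^ 2 / 4 := by
    have hnn : 0 ≤ 1 - s * m ^ 2 / 4 := by nlinarith
    refine abs_le_of_sq_le_sq' ?_ hnn |>.2
    have h1 : ‖1 - (1 - l) * s‖ ^ 2 = 1 - 2 * s * (1 - l.re) + s ^ 2 * m ^ 2 := by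
      rw [hm]
      simp only [Complex.sq_norm, Complex.normSq_apply, Complex.sub_re, Complex.sub_im,
        Complex.mul_re, Complex.mul_im, Complex.one_re, Complex.one_im, Complex.ofReal_re,
        Complex.ofReal_im]
      ring
    have h2 : m ^ 2 ≤ 2 * (1 - l.re) := by
      have h3 : ‖l‖ ^ 2 ≤ 1 := pow_le_one₀ hl0 hl
      rw [hm]
      simp only [Complex.sq_norm, Complex.normSq_apply, Complex.sub_re, Complex.sub_im,
        Complex.one_re, Complex.one_im] at h3 ⊢
      linarith
    rw [h1]
    have h3 : s * m ^ 2 ≤ s * (2 * (1 - l.re)) := by gcongr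
    have h4 : s ^ 2 * m ^ 2 ≤ s * (1 / 2) * m ^ 2 := by
      rw [sq s]; gcongr
    nlinarith [sq_nonneg (s * m ^ 2)]
  have hbound : ‖1 - s + l * (s + α * x + β * x ^ 2)‖ ≤
      ‖g‖ * (1 - s * m ^ 2 / 4 + m * (s * (K * ‖x‖))) := by
    rw [hN]
    refine (norm_sub_le _ _).trans ?_
    rw [norm_mul, norm_mul (1 - l)]
    have h1 := mul_le_mul_of_nonneg_left hA (norm_nonneg g)
    have h2 := mul_le_mul_of_nonneg_left he1 hm0
    rw [← hm]
    linarith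
  refine hbound.trans_lt (mul_lt_mul_of_pos_left ?_ (by linarith))
  rw [norm_mul]
  -- For `l` far from `1` the loss `s m² / 4` wins. For `l` near `1`, completing the square leaves
  -- at most `s K² ‖x‖²`, which `ε ‖l x‖²` pays for.
  rcases le_or_gt (1 / 2) m with hm' | hm'
  · have h1 : K * ‖x‖ - m / 4 < 0 := by linarith
    have h2 : 0 < s * m := by positivity
    have h3 := mul_neg_of_pos_of_neg h2 h1
    have h4 : 0 ≤ ε * (‖l‖ * ‖x‖) ^ 2 := by positivity
    linarith
  · have hl2 : 1 / 2 ≤ ‖l‖ := by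
      have : ‖(1 : ℂ)‖ ≤ ‖1 - l‖ + ‖l‖ := by simpa using norm_add_le (1 - l) l
      rw [norm_one] at this
      linarith
    by_cases hxz : x = 0
    · have hmpos : 0 < m := norm_pos_iff.2 (sub_ne_zero.2 (by
        rcases hne with h | h
        · exact absurd hxz h
        · exact h.symm))
      simp only [hxz, norm_zero, mul_zero]
      have : 0 < s * m ^ 2 := by positivity
      linarith
    · have hxpos : 0 < ‖x‖ := norm_pos_iff.2 hxz
      have h1 : 0 ≤ s * m ^ 2 / 4 - m * (s * (K * ‖x‖)) + s * K ^ 2 * ‖x‖ ^ 2 := by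
        have : 0 ≤ s * (m / 2 - K * ‖x‖) ^ 2 := by positivity
        linarith
      have h2 : s * K ^ 2 * ‖x‖ ^ 2 ≤ ε / 8 * ‖x‖ ^ 2 := by gcongr; linarith
      have h3 : ε * (1 / 2 * ‖x‖) ^ 2 ≤ ε * (‖l‖ * ‖x‖) ^ 2 := by gcongr
      have h4 : 0 < ε * ‖x‖ ^ 2 := by positivity
      linarith

/-- If `q = 1 + b σ + c σ²` and `g` is the second order Taylor polynomial of `1 / q`, then
`1 / (‖q‖ - ε ‖σ‖²)` dominates `‖g‖ (1 + ε / 4 ‖σ‖²)` near `0`. -/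
theorem eventually_quadratic_mul_le_one (b c : ℂ) {ε : ℝ} (hε : 0 < ε) :
    ∀ᶠ σ : ℂ in 𝓝 0, (‖1 + b * σ + c * σ ^ 2‖ - ε * ‖σ‖ ^ 2) *
      (‖1 + -b * σ + (b ^ 2 - c) * σ ^ 2‖ * (1 + ε / 4 * ‖σ‖ ^ 2)) ≤ 1 := by
  have h1 : ∀ᶠ σ : ℂ in 𝓝 0, 1 / 2 < ‖1 + -b * σ + (b ^ 2 - c) * σ ^ 2‖ := by
    have hc : Continuous fun σ : ℂ => ‖1 + -b * σ + (b ^ 2 - c) * σ ^ 2‖ := by fun_prop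
    exact (hc.tendsto 0).eventually_const_lt (by norm_num)
  have h2 : ∀ᶠ σ : ℂ in 𝓝 0,
      ‖σ * (b * (b ^ 2 - c - c) + c * (b ^ 2 - c) * σ)‖ < ε / 4 := by
    have hc : Continuous fun σ : ℂ => ‖σ * (b * (b ^ 2 - c - c) + c * (b ^ 2 - c) * σ)‖ := by
      fun_prop
    exact (hc.tendsto 0).eventually_lt_const (by simpa using hε)
  filter_upwards [h1, h2] with σ hσ1 hσ2
  set g := 1 + -b * σ + (b ^ 2 - c) * σ ^ 2 with hg
  have h3 : ‖1 + b * σ + c * σ ^ 2‖ * ‖g‖ ≤ 1 + ε / 4 * ‖σ‖ ^ 2 := by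
    rw [← norm_mul]
    have : (1 + b * σ + c * σ ^ 2) * g =
        1 + σ ^ 2 * (σ * (b * (b ^ 2 - c - c) + c * (b ^ 2 - c) * σ)) := by rw [hg]; ring
    rw [this]
    refine (norm_add_le _ _).trans ?_
    rw [norm_one, norm_mul, norm_pow, mul_comm]
    gcongr
  set t := ε * ‖σ‖ ^ 2 with ht
  have ht0 : 0 ≤ t := by positivity
  have h4 : (‖1 + b * σ + c * σ ^ 2‖ - t) * ‖g‖ ≤ 1 - t / 4 := by nlinarith
  have h5 : ε / 4 * ‖σ‖ ^ 2 = t / 4 := by rw [ht]; ring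
  rw [h5, ← mul_assoc]
  calc _ ≤ (1 - t / 4) * (1 + t / 4) := by gcongr
    _ ≤ 1 := by nlinarith [sq_nonneg t]

/-! ### Plurisubharmonic functions and the maximum principle on quadratic discs. -/

theorem IsContinuousPlurisubharmonicOn.comp_affine {E F : Type*} [NormedAddCommGroup E]
    [NormedSpace ℂ E] [NormedAddCommGroup F] [NormedSpace ℂ F] {u : E → ℝ} {D : Set E}
    (hu : IsContinuousPlurisubharmonicOn u D) (a : E) (L : F →L[ℂ] E) :
    IsContinuousPlurisubharmonicOn (fun p => u (a + L p)) {p | a + L p ∈ D} where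
  continuousOn := hu.continuousOn.comp (by fun_prop) fun _ h => h
  le_circleAverage z w h := by
    have key : ∀ τ : ℂ, a + L (z + τ • w) = a + L z + τ • L w := fun τ => by
      rw [map_add, map_smul, add_assoc]
    simp only [key]
    exact hu.le_circleAverage (a + L z) (L w) fun τ hτ => key τ ▸ h τ hτ

theorem continuousOn_disc {E : Type*} [NormedAddCommGroup E]
    [NormedSpace ℂ E] {u : E → ℝ} {D : Set E} (hu : ContinuousOn u D) {z w : E}
    (h : ∀ τ : ℂ, ‖τ‖ ≤ 1 → z + τ • w ∈ D) :
    ContinuousOn (fun τ : ℂ => u (z + τ • w)) (closedBall 0 1) :=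
  hu.comp (by fun_prop) fun τ hτ => h τ (by simpa using hτ)

theorem circleIntegrable_disc {E : Type*} [NormedAddCommGroup E]
    [NormedSpace ℂ E] {u : E → ℝ} {D : Set E} (hu : ContinuousOn u D) {z w : E}
    (h : ∀ τ : ℂ, ‖τ‖ ≤ 1 → z + τ • w ∈ D) :
    CircleIntegrable (fun τ : ℂ => u (z + τ • w)) 0 1 :=
  ContinuousOn.circleIntegrable (by norm_num)
    ((continuousOn_disc hu h).mono sphere_subset_closedBall)

/-- The maximum principle for a continuous plurisubharmonic function on the graph of a quadratic
polynomial. -/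
theorem IsContinuousPlurisubharmonicOn.le_of_le_on_quadratic_circle {V : ℂ × ℂ → ℝ}
    {Ω : Set (ℂ × ℂ)} (hV : IsContinuousPlurisubharmonicOn V Ω) (hΩ : IsOpen Ω) (a b c : ℂ)
    {r m : ℝ} (hr : 0 < r) (hmem : ∀ x : ℂ, ‖x‖ ≤ r → (x, a + b * x + c * x ^ 2) ∈ Ω)
    (hm : ∀ x : ℂ, ‖x‖ = r → V (x, a + b * x + c * x ^ 2) ≤ m) : V (0, a) ≤ m := by
  by_contra! hlt
  set T : ℂ × ℂ → ℂ × ℂ := fun p => (p.1, a + b * p.1 + c * p.1 ^ 2 + p.2) with hT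
  have hTc : Continuous T := by rw [hT]; fun_prop
  have hUo : IsOpen (T ⁻¹' Ω) := hΩ.preimage hTc
  have hVT : ContinuousOn (V ∘ T) (T ⁻¹' Ω) := hV.continuousOn.comp hTc.continuousOn fun _ h => h
  set m' : ℝ := (m + V (0, a)) / 2 with hm'
  have hSo : IsOpen (T ⁻¹' Ω ∩ (V ∘ T) ⁻¹' Set.Iio m') := hVT.isOpen_inter_preimage hUo isOpen_Iio
  obtain ⟨u₁, v₁, -, hv₁, hu₁', hv₁', hsub₁⟩ := generalized_tube_lemma
    (isCompact_closedBall (0 : ℂ) r) (isCompact_singleton (x := (0 : ℂ))) hUo (by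
      rintro ⟨x, y⟩ ⟨hx, rfl⟩
      simpa [hT] using hmem x (by simpa using hx))
  obtain ⟨u₂, v₂, -, hv₂, hu₂', hv₂', hsub₂⟩ := generalized_tube_lemma
    (isCompact_sphere (0 : ℂ) r) (isCompact_singleton (x := (0 : ℂ))) hSo (by
      rintro ⟨x, y⟩ ⟨hx, rfl⟩
      have hx' : ‖x‖ = r := by simpa using hx
      refine ⟨by simpa [hT] using hmem x hx'.le, ?_⟩
      have := hm x hx'
      simp only [hT, Set.mem_preimage, Function.comp, add_zero, Set.mem_Iio, hm']
      linarith)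
  obtain ⟨η, hη, hηsub⟩ := (nhds_basis_closedBall (x := (0 : ℂ))).mem_iff.1
    (inter_mem (hv₁.mem_nhds (hv₁' rfl)) (hv₂.mem_nhds (hv₂' rfl)))
  have hK : ∀ x y : ℂ, ‖x‖ ≤ r → ‖y‖ ≤ η → T (x, y) ∈ Ω := fun x y hx hy =>
    hsub₁ ⟨hu₁' (by simpa using hx), (hηsub (by simpa using hy)).1⟩
  have hS : ∀ x y : ℂ, ‖x‖ = r → ‖y‖ ≤ η → V (T (x, y)) < m' := fun x y hx hy =>
    (hsub₂ ⟨hu₂' (by simpa using hx), (hηsub (by simpa using hy)).2⟩).2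
  have hKc : IsCompact (closedBall (0 : ℂ) r ×ˢ closedBall (0 : ℂ) η) :=
    (isCompact_closedBall _ _).prod (isCompact_closedBall _ _)
  have hVK : ContinuousOn (V ∘ T) (closedBall (0 : ℂ) r ×ˢ closedBall (0 : ℂ) η) :=
    hVT.mono fun p hp => hK p.1 p.2 (by simpa using hp.1) (by simpa using hp.2)
  obtain ⟨B, hB⟩ := hKc.bddAbove_image hVK
  have hB' : ∀ x y : ℂ, ‖x‖ ≤ r → ‖y‖ ≤ η → V (T (x, y)) ≤ B := fun x y hx hy =>
    hB ⟨(x, y), ⟨by simpa using hx, by simpa using hy⟩, rfl⟩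
  -- With `ε r²` equal to half the gap, the maximum of `V ∘ T + ε ‖x‖² - M ‖y‖²` avoids `‖x‖ = r`; a
  -- large `M` keeps it off `‖y‖ = η`.
  set ε : ℝ := (V (0, a) - m) / (2 * r ^ 2) with hεdef
  have hε : 0 < ε := div_pos (by linarith) (by positivity)
  have hεr : ε * r ^ 2 = (V (0, a) - m) / 2 := by rw [hεdef]; field_simp
  obtain ⟨M, hM0, hM⟩ : ∃ M : ℝ, 0 < M ∧ B + ε * r ^ 2 < V (0, a) + M * η ^ 2 := by
    refine ⟨(|B + ε * r ^ 2 - V (0, a)| + 1) / η ^ 2, by positivity, ?_⟩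
    rw [div_mul_cancel₀ _ (by positivity)]
    linarith [le_abs_self (B + ε * r ^ 2 - V (0, a))]
  obtain ⟨⟨x, y⟩, hxy, hmax⟩ := hKc.exists_isMaxOn
    ⟨(0, 0), by simp [hr.le], by simp [hη.le]⟩
    (f := fun p => (V ∘ T) p + ε * ‖p.1‖ ^ 2 - M * ‖p.2‖ ^ 2)
    ((hVK.add (by fun_prop)).sub (by fun_prop))
  have hmax' : ∀ x' y' : ℂ, ‖x'‖ ≤ r → ‖y'‖ ≤ η →
      V (T (x', y')) + ε * ‖x'‖ ^ 2 - M * ‖y'‖ ^ 2 ≤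
        V (T (x, y)) + ε * ‖x‖ ^ 2 - M * ‖y‖ ^ 2 := fun x' y' hx' hy' =>
    hmax (show (x', y') ∈ _ from ⟨by simpa using hx', by simpa using hy'⟩)
  have hxr : ‖x‖ ≤ r := by simpa using hxy.1
  have hyη : ‖y‖ ≤ η := by simpa using hxy.2
  have h00 := hmax' 0 0 (by simpa using hr.le) (by simpa using hη.le)
  have hT0 : T (0, 0) = (0, a) := by simp [hT]
  rw [hT0] at h00
  simp only [norm_zero] at h00
  have hxsq : ε * ‖x‖ ^ 2 ≤ ε * r ^ 2 := by gcongr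
  have hx_lt : ‖x‖ < r := by
    refine lt_of_le_of_ne hxr fun heq => ?_
    have := hS x y heq hyη
    have : 0 ≤ M * ‖y‖ ^ 2 := by positivity
    linarith
  have hy_lt : ‖y‖ < η := by
    refine lt_of_le_of_ne hyη fun heq => ?_
    have := hB' x y hxr hyη
    rw [heq] at h00
    linarith
  obtain ⟨ρ, hρ0, hρ1, hρ2, hρ3⟩ : ∃ ρ : ℝ, 0 < ρ ∧ ‖x‖ + ρ < r ∧ ‖y‖ + ‖c‖ * ρ ^ 2 < η ∧
      M * ‖c‖ ^ 2 * ρ ^ 2 < ε := by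
    have c1 : Continuous fun ρ : ℝ => ‖x‖ + ρ := by fun_prop
    have c2 : Continuous fun ρ : ℝ => ‖y‖ + ‖c‖ * ρ ^ 2 := by fun_prop
    have c3 : Continuous fun ρ : ℝ => M * ‖c‖ ^ 2 * ρ ^ 2 := by fun_prop
    have e1 := (c1.tendsto 0).eventually_lt_const (u := r) (by simpa using hx_lt)
    have e2 := (c2.tendsto 0).eventually_lt_const (u := η) (by simpa using hy_lt)
    have e3 := (c3.tendsto 0).eventually_lt_const (u := ε) (by simpa using hε)
    have e4 : ∀ᶠ ρ : ℝ in 𝓝[>] 0, 0 < ρ := self_mem_nhdsWithin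
    obtain ⟨ρ, ⟨⟨h1, h2⟩, h3⟩, h4⟩ :=
      ((((e1.and e2).and e3).filter_mono nhdsWithin_le_nhds).and e4).exists
    exact ⟨ρ, h4, h1, h2, h3⟩
  -- Plurisubharmonicity only sees complex lines, so the line tangent to the translated graph is
  -- used. It leaves the graph to second order, costing `M ‖c‖² ρ⁴` against the gain `ε ρ²`.
  have hline : ∀ τ : ℂ, T (x, y) + τ • ((ρ : ℂ), (ρ : ℂ) * (b + 2 * c * x)) =
      T (x + ρ * τ, y + -(c * (ρ * τ) ^ 2)) := fun τ => by
    ext <;> simp [hT] <;> ring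
  have hdisc : ∀ τ : ℂ, ‖τ‖ ≤ 1 → ‖x + ρ * τ‖ ≤ r ∧ ‖y + -(c * (ρ * τ) ^ 2)‖ ≤ η := by
    intro τ hτ
    have h1 : ‖(ρ : ℂ) * τ‖ ≤ ρ := by
      rw [norm_mul, Complex.norm_real, Real.norm_of_nonneg hρ0.le]
      exact mul_le_of_le_one_right hρ0.le hτ
    refine ⟨(norm_add_le _ _).trans (by linarith), (norm_add_le _ _).trans ?_⟩
    rw [norm_neg, norm_mul, norm_pow]
    have : ‖c‖ * ‖(ρ : ℂ) * τ‖ ^ 2 ≤ ‖c‖ * ρ ^ 2 := by gcongr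
    linarith
  have hin : ∀ τ : ℂ, ‖τ‖ ≤ 1 →
      T (x, y) + τ • ((ρ : ℂ), (ρ : ℂ) * (b + 2 * c * x)) ∈ Ω := fun τ hτ => by
    rw [hline]; exact hK _ _ (hdisc τ hτ).1 (hdisc τ hτ).2
  set S : ℝ := V (T (x, y)) - ε * ρ ^ 2 + M * ‖c‖ ^ 2 * ρ ^ 4 with hSdef
  set p : ℂ[X] := C (S : ℂ) + C (((-(2 * ε * ρ) : ℝ) : ℂ) * (starRingEnd ℂ) x) * X +
    C (((2 * M * ρ ^ 2 : ℝ) : ℂ) * ((starRingEnd ℂ) y * -c)) * X ^ 2 with hp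
  have hsub := hV.le_circleAverage _ _ hin
  have hbound : ∀ τ ∈ sphere (0 : ℂ) |1|,
      V (T (x, y) + τ • ((ρ : ℂ), (ρ : ℂ) * (b + 2 * c * x))) ≤ (p.eval τ).re := by
    intro τ hτ
    have hτ1 : ‖τ‖ = 1 := by simpa using hτ
    rw [hline]
    have h1 := hmax' _ _ (hdisc τ hτ1.le).1 (hdisc τ hτ1.le).2
    rw [norm_add_sq_complex, norm_add_sq_complex] at h1
    have h2 : ‖(ρ : ℂ) * τ‖ = ρ := by
      rw [norm_mul, Complex.norm_real, Real.norm_of_nonneg hρ0.le, hτ1, mul_one]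
    rw [norm_neg, norm_mul c, norm_pow, h2] at h1
    have h3 : (p.eval τ).re = S - 2 * ε * ((starRingEnd ℂ) x * (ρ * τ)).re +
        2 * M * ((starRingEnd ℂ) y * -(c * (ρ * τ) ^ 2)).re := by
      have : p.eval τ = (S : ℂ) + ((-(2 * ε) : ℝ) : ℂ) * ((starRingEnd ℂ) x * (ρ * τ)) +
          ((2 * M : ℝ) : ℂ) * ((starRingEnd ℂ) y * -(c * (ρ * τ) ^ 2)) := by
        rw [hp]
        simp only [eval_add, eval_mul, eval_C, eval_X, eval_pow]
        push_cast
        ring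
      rw [this, Complex.add_re, Complex.add_re, Complex.re_ofReal_mul, Complex.re_ofReal_mul,
        Complex.ofReal_re]
      ring
    rw [h3, hSdef]
    linarith
  have hle := Real.circleAverage_mono (circleIntegrable_disc hV.continuousOn hin)
    (ContinuousOn.circleIntegrable (by norm_num)
        (Complex.continuous_re.comp p.continuous).continuousOn) hbound
  have hp0 : p.eval 0 = S := by simp [hp]
  rw [Function.comp_def, circleAverage_re_eval, hp0, Complex.ofReal_re] at hle
  have : M * ‖c‖ ^ 2 * ρ ^ 2 * ρ ^ 2 < ε * ρ ^ 2 := by gcongr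
  rw [hSdef] at hle
  linarith

/-! ### Discs violating pseudoconvexity of a balanced domain. -/

theorem add_mem_largestBalanced {E : Type*} [NormedAddCommGroup E]
    [NormedSpace ℂ E] {D : Set E} {z X : E} :
    z + X ∈ largestBalanced D z ↔ ∀ l : ℂ, ‖l‖ ≤ 1 → z + l • X ∈ D := by
  simp [largestBalanced, balancedIndicatrix]

theorem largestBalanced_subset {E : Type*} [NormedAddCommGroup E] [NormedSpace ℂ E] {D : Set E}
    {z : E} : largestBalanced D z ⊆ D := by
  rintro _ ⟨X, hX, rfl⟩
  simpa using hX 1 (by simp)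

/-- A set containing a Hartogs-type neighbourhood `‖ζ‖ < ‖1 + α σ + β σ²‖ (1 + ε ‖σ‖²)` of a disc,
but not the point `(σ, ζ) = (0, 1)`, has a largest balanced domain that is not pseudoconvex. -/
theorem exists_not_isPseudoconvex_largestBalanced {E : Type*} [NormedAddCommGroup E]
    [NormedSpace ℂ E] [FiniteDimensional ℂ E] {D : Set E} {z w X : E} {α β : ℂ} {ε r : ℝ}
    (hε : 0 < ε) (hr : 0 < r) (hX : z + X ∉ D)
    (h : ∀ σ ζ : ℂ, ‖σ‖ ≤ r → ‖ζ‖ < ‖1 + α * σ + β * σ ^ 2‖ * (1 + ε * ‖σ‖ ^ 2) →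
      z + σ • w + ζ • X ∈ D) :
    ∃ z' ∈ D, ¬ IsPseudoconvex (largestBalanced D z') := by
  obtain ⟨s, hs0, hs1, r', hr', hlt⟩ := exists_norm_lt_norm_quadratic α β hε
  set z' : E := z + ((1 - s : ℝ) : ℂ) • X with hz'
  refine ⟨z', ?_, ?_⟩
  · have := h 0 ((1 - s : ℝ) : ℂ) (by simpa using hr.le) (by
      rw [Complex.norm_real, Real.norm_of_nonneg (by linarith)]
      simpa using hs0)
    simpa [hz'] using this
  rintro ⟨hBo, u, hu, hcomp⟩
  set B := largestBalanced D z' with hB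
  set L : ℂ × ℂ →L[ℂ] E := (ContinuousLinearMap.fst ℂ ℂ ℂ).smulRight w +
    (ContinuousLinearMap.snd ℂ ℂ ℂ).smulRight X with hL
  have hLapp : ∀ x y : ℂ, L (x, y) = x • w + y • X := fun x y => by simp [hL]
  have hV := hu.comp_affine z' L
  set Ω : Set (ℂ × ℂ) := {p | z' + L p ∈ B} with hΩ
  have hΩo : IsOpen Ω := hBo.preimage (by fun_prop)
  set ρ₀ := min r r' with hρ₀
  have hρ₀pos : 0 < ρ₀ := lt_min hr hr'
  have hmem : ∀ (ρ : ℝ) (x : ℂ), 0 ≤ ρ → ρ ≤ 1 → ‖x‖ ≤ ρ₀ → (ρ < 1 ∨ x ≠ 0) →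
      ((ρ : ℂ) * x, (ρ : ℂ) * (s + α * x + β * x ^ 2)) ∈ Ω := by
    intro ρ x hρ0 hρ1 hx hor
    rw [hΩ, Set.mem_ofPred_eq, hB, add_mem_largestBalanced]
    intro l hl
    have hn : ‖l * ρ‖ ≤ ρ := by
      rw [norm_mul, Complex.norm_real, Real.norm_of_nonneg hρ0]
      exact mul_le_of_le_one_left hρ0 hl
    have h1 := hlt x (l * ρ) (hx.trans (min_le_right _ _)) (hn.trans hρ1) (by
      rcases hor with h1 | h1
      · right
        intro h2
        rw [h2, norm_one] at hn
        linarith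
      · exact Or.inl h1)
    have h2 := h (l * ρ * x) _ (by
      rw [norm_mul]
      exact (mul_le_of_le_one_left (norm_nonneg _) (hn.trans hρ1)).trans
        (hx.trans (min_le_left _ _))) h1
    convert h2 using 1
    rw [hLapp, hz']
    push_cast
    module
  -- The boundary circles, including those for `ρ = 1`, sweep out a compact subset of `Ω`, since
  -- only `ρ = 1, x = 0` must be excluded.
  have hcpt : IsCompact ((fun q : ℝ × ℂ => ((q.1 : ℂ) * q.2,
      (q.1 : ℂ) * (s + α * q.2 + β * q.2 ^ 2))) '' (Set.Icc 0 1 ×ˢ sphere (0 : ℂ) ρ₀)) :=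
    (isCompact_Icc.prod (isCompact_sphere _ _)).image (by fun_prop)
  obtain ⟨m, hm⟩ := hcpt.bddAbove_image (f := fun p => u (z' + L p)) (hV.continuousOn.mono (by
    rintro _ ⟨⟨ρ, x⟩, ⟨hρ, hx⟩, rfl⟩
    have hx' : ‖x‖ = ρ₀ := by simpa using hx
    exact hmem ρ x hρ.1 hρ.2 hx'.le (Or.inr (norm_pos_iff.1 (by rw [hx']; exact hρ₀pos)))))
  have hle : ∀ ρ : ℝ, 0 < ρ → ρ < 1 → u (z' + L (0, (ρ : ℂ) * s)) ≤ m := by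
    intro ρ hρ0 hρ1
    have hρne : (ρ : ℂ) ≠ 0 := by exact_mod_cast hρ0.ne'
    -- The disc scaled by `ρ` is again a quadratic graph over the first coordinate.
    have key : ∀ x : ℂ, (x, (ρ : ℂ) * s + α * x + β / ρ * x ^ 2) =
        ((ρ : ℂ) * (x / ρ), (ρ : ℂ) * (s + α * (x / ρ) + β * (x / ρ) ^ 2)) := fun x => by
      ext <;> dsimp only <;> field_simp
    have hnorm : ∀ x : ℂ, ‖x / ρ‖ = ‖x‖ / ρ := fun x => by
      rw [norm_div, Complex.norm_real, Real.norm_of_nonneg hρ0.le]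
    refine hV.le_of_le_on_quadratic_circle hΩo ((ρ : ℂ) * s) α (β / ρ) (r := ρ * ρ₀)
      (by positivity) (fun x hx => ?_) (fun x hx => ?_)
    · rw [key]
      exact hmem ρ _ hρ0.le hρ1.le (by rw [hnorm, div_le_iff₀ hρ0]; linarith) (Or.inl hρ1)
    · rw [key]
      refine hm ⟨_, ⟨(ρ, x / ρ), ⟨⟨hρ0.le, hρ1.le⟩, ?_⟩, rfl⟩, rfl⟩
      rw [mem_sphere_zero_iff_norm, hnorm, hx]
      field_simp
  have hlim : Tendsto (fun ρ : ℝ => z' + L (0, (ρ : ℂ) * s)) (𝓝[<] 1) (𝓝 (z + X)) := by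
    have hc : Continuous fun ρ : ℝ => z' + L (0, (ρ : ℂ) * s) := by fun_prop
    have h1 := hc.tendsto 1
    have h2 : z' + L (0, ((1 : ℝ) : ℂ) * s) = z + X := by
      rw [hLapp, hz']; push_cast; module
    rw [h2] at h1
    exact h1.mono_left nhdsWithin_le_nhds
  refine hX (largestBalanced_subset (hB ▸ (hcomp (m + 1)).2 (mem_closure_of_tendsto hlim ?_)))
  have e1 : ∀ᶠ ρ : ℝ in 𝓝[<] 1, ρ < 1 := self_mem_nhdsWithin
  have e2 : ∀ᶠ ρ : ℝ in 𝓝[<] 1, 0 < ρ :=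
    (eventually_gt_nhds one_pos).filter_mono nhdsWithin_le_nhds
  filter_upwards [e1, e2] with ρ hρ1 hρ0
  refine ⟨?_, by linarith [hle ρ hρ0 hρ1]⟩
  have := hmem ρ 0 hρ0.le hρ1.le (by simpa using hρ₀pos.le) (Or.inl hρ1)
  simpa [hΩ] using this

/-! ### From the balanced domains back to `D`. -/

/-- The real part of a norming functional at `z` is a minorant of the norm with equality at `z`. -/
theorem isContinuousPlurisubharmonicOn_norm {E : Type*} [NormedAddCommGroup E]
    [NormedSpace ℂ E] :
    IsContinuousPlurisubharmonicOn (fun z : E => ‖z‖) Set.univ where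
  continuousOn := continuous_norm.continuousOn
  le_circleAverage z w _ := by
    obtain ⟨φ, hφ, hφz⟩ := exists_dual_vector'' ℂ z
    have h1 := circleAverage_re_eval (C (φ z) + C (φ w) * X)
    simp only [eval_add, eval_mul, eval_C, eval_X, mul_zero, add_zero, hφz] at h1
    refine h1.ge.trans ?_
    refine Real.circleAverage_mono (ContinuousOn.circleIntegrable (by norm_num) (by fun_prop))
      (ContinuousOn.circleIntegrable (by norm_num) (by fun_prop)) fun τ _ => ?_
    have h2 : ((‖z‖ : ℝ) : ℂ) + φ w * τ = φ (z + τ • w) := by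
      rw [map_add, map_smul, hφz, smul_eq_mul, mul_comm]; rfl
    have h3 : (φ (z + τ • w)).re ≤ ‖z + τ • w‖ :=
      (Complex.re_le_norm _).trans ((φ.le_of_opNorm_le hφ _).trans (by rw [one_mul]))
    rw [← h2] at h3
    exact h3

theorem infDist_compl_pos {E : Type*} [NormedAddCommGroup E] {D : Set E} (hD : IsOpen D)
    (hproper : D ≠ Set.univ) {z : E} (hz : z ∈ D) : 0 < infDist z Dᶜ :=
  (hD.isClosed_compl.notMem_iff_infDist_pos (Set.nonempty_compl.2 hproper)).1 (by simpa using hz)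

theorem isContinuousPlurisubharmonicOn_inv_infDist {E : Type*} [NormedAddCommGroup E]
    [NormedSpace ℂ E] [FiniteDimensional ℂ E] {D : Set E} (hD : IsOpen D) (hproper : D ≠ Set.univ)
    (h : ∀ z ∈ D, IsPseudoconvex (largestBalanced D z)) :
    IsContinuousPlurisubharmonicOn (fun z => (infDist z Dᶜ)⁻¹) D := by
  have : ProperSpace E := FiniteDimensional.proper ℂ E
  have hne : (Dᶜ).Nonempty := Set.nonempty_compl.2 hproper
  have hpos : ∀ z ∈ D, 0 < infDist z Dᶜ := fun z hz => infDist_compl_pos hD hproper hz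
  have hdc : ContinuousOn (fun z => (infDist z Dᶜ)⁻¹) D :=
    (continuous_infDist_pt _).continuousOn.inv₀ fun z hz => (hpos z hz).ne'
  refine ⟨hdc, ?_⟩
  intro z₀ w hdisc
  have key := le_circleAverage_of_not_touched (continuousOn_disc hdc hdisc) ?_
  · simpa using key
  intro τ₀ hτ₀ b c ε hε r hr
  by_contra! hcon
  set z : E := z₀ + τ₀ • w with hz
  have hτ₀' : ‖τ₀‖ < 1 := by simpa using hτ₀
  have hzD : z ∈ D := hdisc τ₀ hτ₀'.le
  set R : ℝ := infDist z Dᶜ with hR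
  have hRpos : 0 < R := hpos z hzD
  obtain ⟨p, hpD, hp⟩ := hD.isClosed_compl.exists_infDist_eq_dist hne z
  have hRe : 0 < R * ε := by positivity
  obtain ⟨r₁, hr₁, hnum⟩ := Metric.eventually_nhds_iff.1
    (eventually_quadratic_mul_le_one (R * b) (R * c) hRe)
  -- `α` and `β` are the Taylor coefficients of `1 / (1 + R b σ + R c σ²)`, whose modulus bounds
  -- `infDist / R` from below to second order.
  obtain ⟨z', hz'D, hz'⟩ := exists_not_isPseudoconvex_largestBalanced (D := D) (z := z) (w := w)
    (X := p - z) (α := -(R * b)) (β := (R * b) ^ 2 - R * c) (ε := R * ε / 4)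
    (r := min (min r (1 - ‖τ₀‖)) (r₁ / 2)) (by positivity)
    (lt_min (lt_min hr (by linarith)) (by positivity)) (by simpa using hpD) (by
      intro σ ζ hσ hζ
      have hσr : ‖σ‖ ≤ r := hσ.trans ((min_le_left _ _).trans (min_le_left _ _))
      have hσ1 : ‖σ‖ ≤ 1 - ‖τ₀‖ := hσ.trans ((min_le_left _ _).trans (min_le_right _ _))
      have hnum' := hnum (y := σ) (by
        rw [dist_zero_right]; linarith [hσ.trans (min_le_right _ _)])
      have hc := hcon σ hσr
      have hzσ : z₀ + (τ₀ + σ) • w = z + σ • w := by rw [hz]; module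
      rw [hzσ] at hc
      have hzσD : z + σ • w ∈ D := hzσ ▸ hdisc (τ₀ + σ) ((norm_add_le _ _).trans (by linarith))
      set d := infDist (z + σ • w) Dᶜ with hd
      have hdpos : 0 < d := hpos _ hzσD
      set G := ‖1 + -(R * b) * σ + ((R * b) ^ 2 - R * c) * σ ^ 2‖ *
        (1 + R * ε / 4 * ‖σ‖ ^ 2) with hG
      have hG0 : 0 ≤ G := by positivity
      have hA : R ≤ d * (‖1 + R * b * σ + R * c * σ ^ 2‖ - R * ε * ‖σ‖ ^ 2) := by
        have h1 : R * d⁻¹ ≤ ‖1 + R * b * σ + R * c * σ ^ 2‖ - R * ε * ‖σ‖ ^ 2 := by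
          have h2 : (1 + R * b * σ + R * c * σ ^ 2).re = 1 + R * (b * σ + c * σ ^ 2).re := by
            rw [← Complex.re_ofReal_mul, ← Complex.one_re, ← Complex.add_re]
            congr 1; ring
          have h3 := Complex.re_le_norm (1 + R * b * σ + R * c * σ ^ 2)
          have h4 := mul_le_mul_of_nonneg_left hc hRpos.le
          have h5 : R * R⁻¹ = 1 := mul_inv_cancel₀ hRpos.ne'
          linarith
        calc R = d * (R * d⁻¹) := by field_simp
          _ ≤ _ := by gcongr
      have hRG : R * G ≤ d := by
        calc R * G ≤ d * (‖1 + R * b * σ + R * c * σ ^ 2‖ - R * ε * ‖σ‖ ^ 2) * G := by gcongr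
          _ = d * ((‖1 + R * b * σ + R * c * σ ^ 2‖ - R * ε * ‖σ‖ ^ 2) * G) := by ring
          _ ≤ d * 1 := by gcongr
          _ = d := mul_one d
      -- The ball of radius `d` about `z + σ w` lies in `D`, and `‖p - z‖ = R`.
      by_contra hnot
      have h6 : d ≤ dist (z + σ • w) (z + σ • w + ζ • (p - z)) :=
        infDist_le_dist_of_mem hnot
      rw [dist_self_add_right, norm_smul, ← dist_eq_norm, dist_comm, ← hp, ← hR] at h6
      have h7 : ‖ζ‖ * R < G * R := by gcongr
      linarith)
  exact hz' (h z' hz'D)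

theorem isPseudoconvex_of_largestBalanced {E : Type*} [NormedAddCommGroup E]
    [NormedSpace ℂ E] [FiniteDimensional ℂ E] {D : Set E} (hD : IsOpen D) (hproper : D ≠ Set.univ)
    (h : ∀ z ∈ D, IsPseudoconvex (largestBalanced D z)) : IsPseudoconvex D := by
  have : ProperSpace E := FiniteDimensional.proper ℂ E
  have hpos : ∀ z ∈ D, 0 < infDist z Dᶜ := fun z hz => infDist_compl_pos hD hproper hz
  have hu := isContinuousPlurisubharmonicOn_inv_infDist hD hproper h
  have hdc := hu.continuousOn
  -- The norm is added because `D` may be unbounded.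
  refine ⟨hD, fun z => (infDist z Dᶜ)⁻¹ + ‖z‖, ⟨hdc.add continuous_norm.continuousOn, ?_⟩, ?_⟩
  · intro z w hdisc
    have hnorm := isContinuousPlurisubharmonicOn_norm (E := E)
    have h2 := hnorm.le_circleAverage z w fun _ _ => trivial
    have hI := circleIntegrable_disc hnorm.continuousOn (z := z) (w := w) fun _ _ => trivial
    rw [Real.circleAverage_fun_add (circleIntegrable_disc hdc hdisc) hI]
    exact add_le_add (hu.le_circleAverage z w hdisc) h2
  · intro c
    -- Without division the condition is closed and fails off `D`, where `infDist` is `0` and its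
    -- inverse would be `0` too.
    set K : Set E := closedBall 0 c ∩ {z | 1 ≤ c * infDist z Dᶜ} with hK
    have hKc : IsCompact K := (isCompact_closedBall 0 c).inter_right
      (isClosed_le continuous_const ((continuous_infDist_pt _).const_mul c))
    have hKD : K ⊆ D := by
      rintro z ⟨-, hz⟩
      by_contra hnot
      have : infDist z Dᶜ = 0 := infDist_zero_of_mem hnot
      simp only [Set.mem_ofPred_eq, this, mul_zero] at hz
      linarith
    have hsubK : closure {z ∈ D | (infDist z Dᶜ)⁻¹ + ‖z‖ < c} ⊆ K := by
      refine closure_minimal ?_ hKc.isClosed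
      rintro z ⟨hz, hzc⟩
      have h1 := hpos z hz
      have h2 : 0 < (infDist z Dᶜ)⁻¹ := inv_pos.2 h1
      have h3 := norm_nonneg z
      refine ⟨by rw [mem_closedBall_zero_iff]; linarith, ?_⟩
      have h4 : (infDist z Dᶜ)⁻¹ * infDist z Dᶜ = 1 := inv_mul_cancel₀ h1.ne'
      have h5 : (infDist z Dᶜ)⁻¹ * infDist z Dᶜ ≤ c * infDist z Dᶜ := by gcongr; linarith
      simp only [Set.mem_ofPred_eq]
      linarith
    exact ⟨hKc.of_isClosed_subset isClosed_closure hsubK, hsubK.trans hKD⟩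

/-! ### From `D` to `H_D` and its slices. -/

theorem isOpen_hartogsLike {E : Type*} [NormedAddCommGroup E] [NormedSpace ℂ E] {D : Set E}
    (hD : IsOpen D) : IsOpen (hartogsLike D) := by
  have hset : hartogsLike D = {p : E × E | ∀ l ∈ closedBall (0 : ℂ) 1, p.1 + l • p.2 ∈ D} := by
    ext ⟨z, w⟩
    simp only [hartogsLike, balancedIndicatrix, Set.mem_ofPred_eq, mem_closedBall_zero_iff]
    exact ⟨fun h => h.2, fun h => ⟨by simpa using h 0 (by simp), h⟩⟩
  rw [hset, isOpen_iff_mem_nhds]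
  intro p hp
  have hc : Continuous fun q : (E × E) × ℂ => q.1.1 + q.2 • q.1.2 := by fun_prop
  exact (isCompact_closedBall (0 : ℂ) 1).eventually_forall_of_forall_eventually fun l hl =>
    hc.continuousAt.eventually (hD.mem_nhds (hp l hl))

/-- Each `(z, w) ↦ u (z + l w)` is plurisubharmonic, and so is the supremum over `‖l‖ ≤ 1`,
continuous by compactness of the disc. -/
theorem IsPseudoconvex.hartogsLike {E : Type*} [NormedAddCommGroup E] [NormedSpace ℂ E]
    [FiniteDimensional ℂ E] {D : Set E} (h : IsPseudoconvex D) :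
    IsPseudoconvex (hartogsLike D) := by
  have : ProperSpace E := FiniteDimensional.proper ℂ E
  obtain ⟨hD, u, hu, hcomp⟩ := h
  have hcont : ∀ p ∈ _root_.hartogsLike D,
      ContinuousOn (fun l : ℂ => u (p.1 + l • p.2)) (closedBall 0 1) := fun p hp =>
    continuousOn_disc hu.continuousOn hp.2
  set v : E × E → ℝ := fun p => sSup ((fun l : ℂ => u (p.1 + l • p.2)) '' closedBall 0 1) with hv
  have hle : ∀ p ∈ _root_.hartogsLike D, ∀ l : ℂ, ‖l‖ ≤ 1 → u (p.1 + l • p.2) ≤ v p :=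
    fun p hp l hl => le_csSup ((isCompact_closedBall _ _).bddAbove_image (hcont p hp))
      ⟨l, by simpa using hl, rfl⟩
  have hvc : ContinuousOn v (_root_.hartogsLike D) := by
    rw [continuousOn_iff_continuous_domRestrict]
    have hf : Continuous (Function.uncurry fun (p : _root_.hartogsLike D)
        (l : closedBall (0 : ℂ) 1) => u (p.1.1 + l.1 • p.1.2)) :=
      hu.continuousOn.comp_continuous (by fun_prop) fun q =>
        q.1.2.2 q.2.1 (mem_closedBall_zero_iff.1 q.2.2)
    have h1 := (isCompact_univ (X := closedBall (0 : ℂ) 1)).continuous_sSup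
      (f := fun (p : _root_.hartogsLike D) (l : closedBall (0 : ℂ) 1) =>
        u (p.1.1 + l.1 • p.1.2)) hf
    convert h1 using 2 with p
    simp only [Set.domRestrict_apply, hv]
    congr 1
    ext t
    simp
  refine ⟨isOpen_hartogsLike hD, v, ⟨hvc, ?_⟩, ?_⟩
  · rintro ⟨z, w⟩ ⟨z', w'⟩ hdisc
    refine csSup_le ((nonempty_closedBall.2 zero_le_one).image _) ?_
    rintro _ ⟨l, hl, rfl⟩
    have hl' : ‖l‖ ≤ 1 := by simpa using hl
    have key : ∀ τ : ℂ, z + l • w + τ • (z' + l • w') =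
        ((z, w) + τ • (z', w')).1 + l • ((z, w) + τ • (z', w')).2 := fun τ => by
      simp only [Prod.fst_add, Prod.snd_add, Prod.smul_fst, Prod.smul_snd]
      module
    have hin : ∀ τ : ℂ, ‖τ‖ ≤ 1 → z + l • w + τ • (z' + l • w') ∈ D := fun τ hτ => by
      rw [key]; exact (hdisc τ hτ).2 l hl'
    refine (hu.le_circleAverage _ _ hin).trans
      (Real.circleAverage_mono (circleIntegrable_disc hu.continuousOn hin)
        (circleIntegrable_disc hvc hdisc) fun τ hτ => ?_)
    have hτ1 : ‖τ‖ ≤ 1 := by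
      have : ‖τ‖ = 1 := by simpa using hτ
      exact this.le
    rw [key]
    exact hle _ (hdisc τ hτ1) l hl'
  · intro c
    set K : Set E := closure {z ∈ D | u z < c} with hK
    have hKc : IsCompact K := (hcomp c).1
    set K' : Set (E × E) := {p | ∀ l : ℂ, ‖l‖ ≤ 1 → p.1 + l • p.2 ∈ K} with hK'
    have hK'closed : IsClosed K' := by
      simp only [hK', Set.ofPred_forall]
      exact isClosed_iInter fun l => isClosed_iInter fun _ =>
        isClosed_closure.preimage (by fun_prop)
    -- The values `l = 0` and `l = 1` put `z` and `z + w` in `K`, which bounds the pair.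
    have hK'c : IsCompact K' := by
      refine ((hKc.prod hKc).image (f := fun q : E × E => (q.1, q.2 - q.1))
        (by fun_prop)).of_isClosed_subset hK'closed ?_
      rintro ⟨z, w⟩ hp
      refine ⟨(z, z + w), ⟨by simpa using hp 0 (by simp), by simpa using hp 1 (by simp)⟩, ?_⟩
      simp
    have hsub : closure {p ∈ _root_.hartogsLike D | v p < c} ⊆ K' :=
      closure_minimal (fun p hp l hl => subset_closure
        ⟨hp.1.2 l hl, (hle p hp.1 l hl).trans_lt hp.2⟩) hK'closed
    refine ⟨hK'c.of_isClosed_subset isClosed_closure hsub, hsub.trans fun p hp => ?_⟩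
    exact ⟨(hcomp c).2 (by simpa using hp 0 (by simp)), fun l hl => (hcomp c).2 (hp l hl)⟩

/-- The affine embedding `y ↦ (z, y - z)` identifies the balanced domain with a slice of `H_D`, and
the exhaustion restricts. -/
theorem IsPseudoconvex.largestBalanced_of_hartogsLike {E : Type*} [NormedAddCommGroup E]
    [NormedSpace ℂ E] [FiniteDimensional ℂ E] {D : Set E}
    (h : IsPseudoconvex (_root_.hartogsLike D)) {z : E} (hz : z ∈ D) :
    IsPseudoconvex (largestBalanced D z) := by
  obtain ⟨hH, v, hv, hcomp⟩ := h
  have hset : largestBalanced D z =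
      {y : E | (z, -z) + ContinuousLinearMap.inr ℂ E E y ∈ _root_.hartogsLike D} := by
    ext y
    obtain ⟨X, rfl⟩ : ∃ X, y = z + X := ⟨y - z, by abel⟩
    rw [add_mem_largestBalanced]
    simp [_root_.hartogsLike, balancedIndicatrix, hz]
  have hmap : Continuous fun y : E => (z, -z) + ContinuousLinearMap.inr ℂ E E y := by fun_prop
  rw [hset]
  refine ⟨hH.preimage hmap, _, hv.comp_affine (z, -z) (ContinuousLinearMap.inr ℂ E E), fun c => ?_⟩
  have hsub : closure {y ∈ {y : E | (z, -z) + ContinuousLinearMap.inr ℂ E E y ∈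
      _root_.hartogsLike D} | v ((z, -z) + ContinuousLinearMap.inr ℂ E E y) < c} ⊆
      (fun y : E => (z, -z) + ContinuousLinearMap.inr ℂ E E y) ⁻¹'
        closure {p ∈ _root_.hartogsLike D | v p < c} :=
    closure_minimal (fun y hy => subset_closure hy) (isClosed_closure.preimage hmap)
  refine ⟨?_, hsub.trans fun y hy => (hcomp c).2 hy⟩
  refine ((hcomp c).1.image (f := fun p : E × E => p.2 + z) (by fun_prop)).of_isClosed_subset
    isClosed_closure fun y hy => ⟨_, hsub hy, ?_⟩
  simp

theorem mainTheorem1 (n : ℕ) (D : Set (EuclideanSpace ℂ (Fin n))) (hD : IsOpen D)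
    (hproper : D ≠ Set.univ) :
    List.TFAE [IsPseudoconvex D, IsPseudoconvex (hartogsLike D),
      ∀ z ∈ D, IsPseudoconvex (largestBalanced D z)] := by
  tfae_have 1 → 2 := fun h => h.hartogsLike
  tfae_have 2 → 3 := fun h z hz => h.largestBalanced_of_hartogsLike hz
  tfae_have 3 → 1 := isPseudoconvex_of_largestBalanced hD hproper
  tfae_finish
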